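/- **Setting.** Let $G=(V,E)$ be a finite directed graph on $n=|V|$ users and let $r\ge 1$ be the number of features. Feature $i\in\{1,\dots,r\}$ has a weight $w^i\ge 0$, with $\sum_{i=1}^r w^i=1$ and $\bar w=\max_i w^i$, and each edge $(u,v)\in E$ has an activation probability $p^i_{uv}\in[0,1]$ for feature $i$. Layer $i$ is a copy $G^i$ of $G$ with feature nodes $v^i$ ($v\in V$). A realization $\mathrm g^i$ of layer $i$ is a random set of live edges: each edge $(u,v)$ is live independently with probability $p^i_{uv}$, and the layers are independent. Let $S_r\subseteq V$ be the rumor seed set, $n_r=|S_r|$, and let $S_r^i\subseteq S_r$ be the users whose copy in layer $i$ accepts the rumor initially. For a positive seed set $S\subseteq V\setminus S_r$, all copies of the users of $S$ accept the positive cascade initially. In each layer both cascades spread in discrete steps along the live edges, each node keeps the first cascade it accepts, and the rumor has priority in a tie. Let $r(v^i)=1$ if $v^i$ finally accepts the rumor and $r(v^i)=0$ otherwise. With thresholds $\theta_v$ independent of the realizations and uniform on $[0,1]$, user $v$ is $\bar C_r$-active (not activated by the rumor) if $\sum_i w^i(1-r(v^i))\ge\theta_v$; $f(S)$ is the expected number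 of $\bar C_r$-active users. The problem MFRB (multi-feature rumor blocking) is to maximize $f(S)$ over $S\subseteq V\setminus S_r$, $|S|\le k$; its optimal value is $\mathrm{OPT}$. Assume $1\le k\le n-n_r$. An $\alpha$-approximate solution is a feasible $S$ with $f(S)\ge\alpha\,\mathrm{OPT}$. **Multi-Sampling.** Choose a feature node $v^i$ uniformly among all $nr$ feature nodes, generate a realization $\mathrm g^i$ of layer $i$, and search backwards from $v^i$ along live edges, breadth first, level by level. At the first level that meets $S_r^i$, return the set of all nodes in the earlier levels; if no level meets $S_r^i$, return all nodes of layer $i$. For samples $\mathcal R=(R_1,\dots,R_\theta)$ put $$W_{\mathcal R}(S)=\frac1\theta\sum_{i=1}^r w^i\sum_{j=1}^\theta x(S^i,R_j),$$ where $S^i$ is the copy of $S$ in layer $i$ and $x(A,R)=1$ if $A\cap R\ne\emptyset$, and $0$ otherwise. Greedy node selection starts from $S=\emptyset$ and, in each of $k$ rounds, adds to $S$ a user $u\in V\setminus(S_r\cup S)$ that maximizes $W_{\mathcal R}(S\cup\{u\})-W_{\mathcal R}(S)$, ties being broken arbitrarily. **Theorem.** Let $0<\varepsilon_1<\varepsilon$,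 $\varepsilon_2=\varepsilon-(1-1/e)\varepsilon_1$, $\ell\in\mathbb R$, and $\delta_1,\delta_2\in(0,1)$ with $\delta_1+\delta_2\le 1/n^\ell$. Let $$\theta_1=\frac{2nr\bar w\log(1/\delta_1)}{\varepsilon_1^2\,\mathrm{OPT}},\qquad \theta_2=\frac{(2\bar w+\frac23\varepsilon_2)\,nr\,\log\!\big(\binom{n-n_r}{k}/\delta_2\big)}{\varepsilon_2^2\,\mathrm{OPT}}.$$ If $\mathcal R$ consists of $\theta\ge\max\{\theta_1,\theta_2\}$ independent Multi-Samplings, then with probability at least $1-1/n^\ell$ greedy node selection on $\mathcal R$ returns a $(1-1/e-\varepsilon)$-approximate solution of MFRB (whatever the tie-breaking). -/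

import Mathlib

open MeasureTheory ProbabilityTheory

/-- A directed social network on the users `V` for a product with `r` features, in the
multi-feature diffusion model, together with a rumor seed set. An edge `(u, v)` is directed
from `u` to `v`. The copy of user `v` in layer `i` (a feature node) is the pair `(v, i)`. -/
structure RumorNetwork (V : Type*) [DecidableEq V] (r : ℕ) where
  /-- the directed edges of the social network -/
  edges : Finset (V × V)
  /-- `prob i (u, v)` is the activation probability of feature `i` along the edge `(u, v)` -/
  prob : Fin r → V × V → ℝ
  prob_nonneg : ∀ i, ∀ e ∈ edges, 0 ≤ prob i e
  prob_le_one : ∀ i, ∀ e ∈ edges, prob i e ≤ 1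
  /-- the weight of each feature, common to all users -/
  weight : Fin r → ℝ
  weight_nonneg : ∀ i, 0 ≤ weight i
  weight_sum : ∑ i, weight i = 1
  /-- the users in the rumor seed set -/
  rumorSeeds : Finset V
  /-- the rumor seed users whose feature node in layer `i` accepts the rumor initially
  (possibly not all of them, and possibly different ones in different layers) -/
  rumorLayer : Fin r → Finset V
  rumorLayer_subset : ∀ i, rumorLayer i ⊆ rumorSeeds

section Deterministic

variable {V : Type*} [Fintype V] [DecidableEq V]

/-- Users outside `A ∪ B` having an incoming neighbor in `A` in the realization `g`. -/
def reached (g : Finset (V × V)) (A B : Finset V) : Finset V :=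
  Finset.univ.filter fun v => v ∉ A ∪ B ∧ ∃ u ∈ A, (u, v) ∈ g

/-- The competitive diffusion of rumor and positive cascade in one layer, when the live edges are
those of `g`: the pair (nodes that accepted the rumor, nodes that accepted the positive cascade)
after `t` steps. A node keeps the first cascade that it accepts, and the rumor has priority when
both cascades arrive in the same step. -/
def spread (g : Finset (V × V)) (Sr Sp : Finset V) : ℕ → Finset V × Finset V
  | 0 => (Sr, Sp \ Sr)
  | t + 1 =>
    let A := spread g Sr Sp t
    (A.1 ∪ reached g A.1 A.2, A.2 ∪ (reached g A.2 A.1 \ reached g A.1 A.2))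

/-- The node `v` of the layer finally accepts the rumor. -/
def AcceptsRumor (g : Finset (V × V)) (Sr Sp : Finset V) (v : V) : Prop :=
  ∃ t, v ∈ (spread g Sr Sp t).1

/-- The breadth-first loop of R-sampling: `cur` is the current level and `vis` is the set of the
nodes in the earlier levels. If the level is empty, the whole layer is returned. If the level meets
the rumor seeds, then `vis` is returned. Otherwise the level is added to `vis`, and the next level
consists of the new incoming neighbors, in `g`, of the nodes of the level. -/
def rSamplingLoop (g : Finset (V × V)) (Sr cur vis : Finset V) (h : Disjoint cur vis) :
    Finset V :=
  if cur = ∅ then Finset.univ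
  else if (cur ∩ Sr).Nonempty then vis
  else rSamplingLoop g Sr
    (Finset.univ.filter fun t => t ∉ vis ∪ cur ∧ ∃ u ∈ cur, (t, u) ∈ g) (vis ∪ cur)
    (Finset.disjoint_left.mpr fun _ ht => (Finset.mem_filter.mp ht).2.1)
termination_by (Finset.univ \ vis).card
decreasing_by
  rename_i hne _
  obtain ⟨a, ha⟩ := Finset.nonempty_iff_ne_empty.mpr hne
  have hav : a ∉ vis := Finset.disjoint_left.mp h ha
  refine Finset.card_lt_card ⟨Finset.sdiff_subset_sdiff subset_rfl Finset.subset_union_left, ?_⟩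
  intro hsub
  have := hsub (show a ∈ Finset.univ \ vis by simp [hav])
  simp [ha] at this

/-- R-sampling from the node `v` in the realization `g` of a layer with rumor seeds `Sr`. -/
def rSampling (g : Finset (V × V)) (v : V) (Sr : Finset V) : Finset V :=
  rSamplingLoop g Sr {v} ∅ (Finset.disjoint_empty_right _)

end Deterministic

namespace RumorNetwork

variable {V : Type*} [Fintype V] [DecidableEq V] {r : ℕ}

/-- The probability that `g` is the set of live edges of layer `i`. -/
def realizationProb (N : RumorNetwork V r) (i : Fin r) (g : Finset (V × V)) : ℝ :=
  if g ⊆ N.edges then (∏ e ∈ g, N.prob i e) * ∏ e ∈ N.edges \ g, (1 - N.prob i e) else 0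

theorem realizationProb_nonneg (N : RumorNetwork V r) (i : Fin r) (g : Finset (V × V)) :
    0 ≤ N.realizationProb i g := by
  unfold realizationProb
  split_ifs with h
  · refine mul_nonneg (Finset.prod_nonneg fun e he => N.prob_nonneg i e (h he))
      (Finset.prod_nonneg fun e he => ?_)
    have := N.prob_le_one i e (Finset.mem_sdiff.mp he).1
    linarith
  · exact le_rfl

theorem sum_realizationProb (N : RumorNetwork V r) (i : Fin r) :
    ∑ g, N.realizationProb i g = 1 := by
  have h := Finset.prod_add (fun e => N.prob i e) (fun e => 1 - N.prob i e) N.edges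
  simp only [add_sub_cancel, Finset.prod_const_one] at h
  rw [h]
  symm
  refine Finset.sum_subset_zero_on_sdiff (Finset.subset_univ _) ?_ ?_
  · intro g hg
    simp only [Finset.mem_sdiff, Finset.mem_univ, true_and, Finset.mem_powerset] at hg
    simp [realizationProb, hg]
  · intro g hg
    simp [realizationProb, Finset.mem_powerset.mp hg]

/-- The random realization of layer `i`: each edge is live independently, with its activation
probability for feature `i`. -/
noncomputable def realization (N : RumorNetwork V r) (i : Fin r) : PMF (Finset (V × V)) :=
  PMF.ofFintype (fun g => ENNReal.ofReal (N.realizationProb i g)) (by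
    rw [← ENNReal.ofReal_sum_of_nonneg fun g _ => N.realizationProb_nonneg i g,
      N.sum_realizationProb i, ENNReal.ofReal_one])

open Classical in
/-- The number of users that are not rumor-active, for the realizations `g i` of the layers and the
thresholds `τ v` of the users: the total weight of the features for which `v` does not accept the
rumor has to be at least `τ v`. The positive seed users accept the positive cascade in every
layer. -/
noncomputable def numNotRumorActive (N : RumorNetwork V r) (S : Finset V)
    (g : Fin r → Finset (V × V)) (τ : V → ℝ) : ℕ :=
  (Finset.univ.filter fun v =>
    τ v ≤ ∑ i, N.weight i * (1 - if AcceptsRumor (g i) (N.rumorLayer i) S v then 1 else 0)).card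

/-- The objective `f(S)`: the expected number of users that are not rumor-active for the positive
seed set `S`. The realizations of the layers are independent, and the thresholds are independent of
them and uniform on `[0, 1]`. -/
noncomputable def objective (N : RumorNetwork V r) (S : Finset V) : ℝ :=
  ∑ g : Fin r → Finset (V × V), (∏ i, N.realizationProb i (g i)) *
    ∫ τ, (N.numNotRumorActive S g τ : ℝ)
      ∂(Measure.pi fun _ : V => volume.restrict (Set.Icc (0 : ℝ) 1))

/-- The positive seed sets allowed for the budget `k`. -/
def feasible (N : RumorNetwork V r) (k : ℕ) : Finset (Finset V) :=
  Finset.univ.filter fun S => Disjoint S N.rumorSeeds ∧ S.card ≤ k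

/-- The optimal value of the multi-feature rumor blocking problem with budget `k`. -/
noncomputable def opt (N : RumorNetwork V r) (k : ℕ) : ℝ :=
  (N.feasible k).sup' ⟨∅, by simp [feasible]⟩ N.objective

/-- `S` is a solution, feasible and with value at least `c` times the optimum. -/
def IsApproxSolution (N : RumorNetwork V r) (k : ℕ) (c : ℝ) (S : Finset V) : Prop :=
  S ∈ N.feasible k ∧ c * N.opt k ≤ N.objective S

/-- The maximum weight of a feature. -/
noncomputable def maxWeight [NeZero r] (N : RumorNetwork V r) : ℝ :=
  Finset.univ.sup' Finset.univ_nonempty N.weight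

/-- Multi-Sampling: choose a feature node `(v, i)` uniformly among all feature nodes of all layers,
generate a realization of layer `i`, and return the R-sampling of `v` in it, as a set of feature
nodes of layer `i`. -/
noncomputable def multiSampling [Nonempty V] [NeZero r] (N : RumorNetwork V r) :
    PMF (Finset (V × Fin r)) :=
  (PMF.uniformOfFintype (V × Fin r)).bind fun x =>
    (N.realization x.2).map fun g =>
      (rSampling g x.1 (N.rumorLayer x.2)).image fun v => (v, x.2)

/-- The indicator that the sample `R` is covered by the copy of `S` in layer `i`. -/
def covered (S : Finset V) (i : Fin r) (R : Finset (V × Fin r)) : ℝ :=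
  if ((S.image fun v => (v, i)) ∩ R).Nonempty then 1 else 0

/-- The weighted average fraction of the samples `R 0, …, R (θ - 1)` covered by `S`. -/
noncomputable def coverage (N : RumorNetwork V r) {θ : ℕ} (R : Fin θ → Finset (V × Fin r))
    (S : Finset V) : ℝ :=
  1 / (θ : ℝ) * ∑ i, N.weight i * ∑ j, covered S i (R j)

/-- `N.NodeSelection R k S`: the greedy node selection on the samples `R` can return `S` after `k`
rounds. It starts from the empty set. In each round it adds a user, outside the rumor seed set and
not selected before, of maximum marginal gain in coverage. Ties are broken in any way. -/
inductive NodeSelection (N : RumorNetwork V r) {θ : ℕ} (R : Fin θ → Finset (V × Fin r)) :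
    ℕ → Finset V → Prop
  | init : NodeSelection N R 0 ∅
  | step {j : ℕ} {S : Finset V} {u : V} (hS : NodeSelection N R j S)
      (hu : u ∉ N.rumorSeeds ∧ u ∉ S)
      (hmax : ∀ u', u' ∉ N.rumorSeeds ∧ u' ∉ S →
        N.coverage R (insert u' S) - N.coverage R S ≤
          N.coverage R (insert u S) - N.coverage R S) :
      NodeSelection N R (j + 1) (insert u S)

/-- The first lower bound on the number of samples. -/
noncomputable def theta₁ [NeZero r] (N : RumorNetwork V r) (k : ℕ) (ε₁ δ₁ : ℝ) : ℝ :=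
  2 * Fintype.card V * r * N.maxWeight * Real.log (1 / δ₁) / (ε₁ ^ 2 * N.opt k)

/-- The second lower bound on the number of samples. -/
noncomputable def theta₂ [NeZero r] (N : RumorNetwork V r) (k : ℕ) (ε₂ δ₂ : ℝ) : ℝ :=
  (2 * N.maxWeight + 2 / 3 * ε₂) * Fintype.card V * r *
      Real.log ((Fintype.card V - N.rumorSeeds.card).choose k / δ₂) /
    (ε₂ ^ 2 * N.opt k)


end RumorNetwork

/-! Averaging over the uniform thresholds makes f(S) linear: it is the sum over feature nodes of the
layer weight times the probability of not accepting the rumor. Timing decides acceptance: a node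
accepts the rumor iff the rumor seeds reach it no later than the positive seeds do. Backward search
collects exactly the nodes that reach v strictly before every rumor arrival, so a nonempty S saves v
iff it meets the sample (`inter_rSampling_nonempty_iff`). Hence the weight collected by S on one
Multi-Sampling has mean f(S)/(nr) (`integral_coveredWeight`), and it lies in [0, w̄] because a
sample lives in a single layer.

Let T be a nonempty optimal set. A Chernoff bound with θ₁ samples shows that the coverage of T is at
least (1-ε₁)OPT/(nr), except with probability δ₁. The greedy set depends on the samples, so a
Bernstein bound with θ₂ samples is applied to every k-set of non-rumor users, and the union bound
over C(n-n_r, k) sets costs δ₂ in total. Coverage is monotone and submodular, so greedy selection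
keeps a factor 1-1/e of the coverage of T (`NodeSelection.le_coverage`). Together, (1-1/e)(1-ε₁)OPT
≤ f(S) + ε₂OPT, and ε₂ is chosen to turn this into the claim. -/

/-! ### Walks, competitive diffusion and backward sampling in one layer -/

/-- There is a walk of length at most `t` from `x` to `v` along the edges of `g`. -/
def Within {V : Type*} (g : Finset (V × V)) : ℕ → V → V → Prop
  | 0, x, v => x = v
  | t + 1, x, v => Within g t x v ∨ ∃ u, Within g t x u ∧ (u, v) ∈ g

namespace Within

variable {V : Type*} {g : Finset (V × V)}

theorem mono {s t : ℕ} (h : s ≤ t) {x v : V} (hx : Within g s x v) : Within g t x v := by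
  induction h with
  | refl => exact hx
  | step _ ih => exact Or.inl ih

theorem refl (t : ℕ) (x : V) : Within g t x x := mono (Nat.zero_le t) (show x = x from rfl)

theorem tail {t : ℕ} {x u v : V} (h : Within g t x u) (e : (u, v) ∈ g) : Within g (t + 1) x v :=
  Or.inr ⟨u, h, e⟩

theorem head {t : ℕ} {x u v : V} (e : (x, u) ∈ g) (h : Within g t u v) : Within g (t + 1) x v := by
  induction t generalizing v with
  | zero => exact Or.inr ⟨x, rfl, h ▸ e⟩
  | succ t ih =>
    rcases h with h | ⟨w, h, e'⟩
    · exact Or.inl (ih h)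
    · exact (ih h).tail e'

/-- Diffusion extends walks at their end, backward search at their start; this reconciles the two.
-/
theorem succ_iff_head {t : ℕ} {x v : V} :
    Within g (t + 1) x v ↔ Within g t x v ∨ ∃ u, (x, u) ∈ g ∧ Within g t u v := by
  constructor
  · intro h
    induction t generalizing v with
    | zero =>
      rcases h with h | ⟨u, rfl, e⟩
      · exact Or.inl h
      · exact Or.inr ⟨v, e, rfl⟩
    | succ t ih =>
      rcases h with h | ⟨w, h, e⟩
      · exact Or.inl h
      · rcases ih h with h | ⟨u, e', h⟩
        · exact Or.inl (h.tail e)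
        · exact Or.inr ⟨u, e', h.tail e⟩
  · rintro (h | ⟨u, e, h⟩)
    · exact Or.inl h
    · exact head e h

end Within

section Diffusion

variable {V : Type*}

/-- The node `v` is reached from the set `A` within `t` steps. -/
def ReachedWithin (g : Finset (V × V)) (A : Finset V) (t : ℕ) (v : V) : Prop :=
  ∃ x ∈ A, Within g t x v

namespace ReachedWithin

variable {g : Finset (V × V)} {A : Finset V}

theorem mono {s t : ℕ} (h : s ≤ t) {v : V} : ReachedWithin g A s v → ReachedWithin g A t v :=
  fun ⟨x, hx, hw⟩ => ⟨x, hx, hw.mono h⟩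

theorem tail {t : ℕ} {u v : V} (h : ReachedWithin g A t u) (e : (u, v) ∈ g) :
    ReachedWithin g A (t + 1) v :=
  let ⟨x, hx, hw⟩ := h; ⟨x, hx, hw.tail e⟩

theorem zero_iff {v : V} : ReachedWithin g A 0 v ↔ v ∈ A :=
  ⟨fun ⟨_, hx, hw⟩ => (show _ = v from hw) ▸ hx, fun h => ⟨v, h, Within.refl 0 v⟩⟩

theorem succ_iff {t : ℕ} {v : V} : ReachedWithin g A (t + 1) v ↔
    ReachedWithin g A t v ∨ ∃ u, ReachedWithin g A t u ∧ (u, v) ∈ g := by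
  constructor
  · rintro ⟨x, hx, h | ⟨u, h, e⟩⟩
    · exact Or.inl ⟨x, hx, h⟩
    · exact Or.inr ⟨u, ⟨x, hx, h⟩, e⟩
  · rintro (h | ⟨u, h, e⟩)
    · exact h.mono (Nat.le_succ t)
    · exact h.tail e

end ReachedWithin

variable [Fintype V] [DecidableEq V]

theorem mem_reached {g : Finset (V × V)} {A B : Finset V} {v : V} :
    v ∈ reached g A B ↔ (v ∉ A ∧ v ∉ B) ∧ ∃ u ∈ A, (u, v) ∈ g := by
  simp [reached]

/-- The rumor takes the nodes that it reaches no later than the positive cascade, and the positive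
cascade takes the nodes that it reaches strictly before the rumor. -/
theorem mem_spread (g : Finset (V × V)) (Sr Sp : Finset V) (t : ℕ) (v : V) :
    (v ∈ (spread g Sr Sp t).1 ↔
      ∃ s ≤ t, ReachedWithin g Sr s v ∧ ∀ s' < s, ¬ ReachedWithin g Sp s' v) ∧
    (v ∈ (spread g Sr Sp t).2 ↔
      ∃ s ≤ t, ReachedWithin g Sp s v ∧ ¬ ReachedWithin g Sr s v) := by
  induction t generalizing v with
  | zero =>
    simp only [spread, Nat.le_zero, Finset.mem_sdiff]
    constructor
    · constructor
      · intro h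
        exact ⟨0, rfl, ReachedWithin.zero_iff.2 h, by simp⟩
      · rintro ⟨s, rfl, h, -⟩
        exact ReachedWithin.zero_iff.1 h
    · constructor
      · rintro ⟨h, h'⟩
        exact ⟨0, rfl, ReachedWithin.zero_iff.2 h, mt ReachedWithin.zero_iff.1 h'⟩
      · rintro ⟨s, rfl, h, h'⟩
        exact ⟨ReachedWithin.zero_iff.1 h, mt ReachedWithin.zero_iff.2 h'⟩
  | succ t ih =>
    have sub1 : ∀ u, u ∈ (spread g Sr Sp t).1 → ReachedWithin g Sr t u := fun u hu =>
      let ⟨s, hs, h, _⟩ := (ih u).1.1 hu; h.mono hs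
    have sub2 : ∀ u, u ∈ (spread g Sr Sp t).2 → ReachedWithin g Sp t u := fun u hu =>
      let ⟨s, hs, h, _⟩ := (ih u).2.1 hu; h.mono hs
    -- A node still free after t steps has been reached by neither cascade. Otherwise its first
    -- rumor arrival would either be preceded by a positive one or give it the rumor.
    have cover : ∀ u, u ∉ (spread g Sr Sp t).1 → u ∉ (spread g Sr Sp t).2 →
        ¬ ReachedWithin g Sr t u ∧ ¬ ReachedWithin g Sp t u := by
      intro u h1 h2
      have hr : ¬ ReachedWithin g Sr t u := by
        intro h
        by_cases hb : ∃ s' < t, ReachedWithin g Sp s' u ∧ ¬ ReachedWithin g Sr s' u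
        · obtain ⟨s', hs', hb⟩ := hb
          exact h2 ((ih u).2.2 ⟨s', hs'.le, hb⟩)
        · classical
          push Not at hb
          have hex : ∃ s, ReachedWithin g Sr s u := ⟨t, h⟩
          have hle : Nat.find hex ≤ t := Nat.find_min' hex h
          exact h1 ((ih u).1.2 ⟨Nat.find hex, hle, Nat.find_spec hex, fun s' hs' hp =>
            Nat.find_min hex hs' (hb s' (hs'.trans_le hle) hp)⟩)
      exact ⟨hr, fun hp => h2 ((ih u).2.2 ⟨t, le_rfl, hp, hr⟩)⟩
    -- an in-neighbor reached by the rumor carries the rumor when `v` is still free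
    have carry : ∀ u w, ReachedWithin g Sr t u → (u, w) ∈ g → ¬ ReachedWithin g Sp t w →
        u ∈ (spread g Sr Sp t).1 := by
      intro u w hu e hw
      classical
      have hex : ∃ s, ReachedWithin g Sr s u := ⟨t, hu⟩
      have hle : Nat.find hex ≤ t := Nat.find_min' hex hu
      exact (ih u).1.2 ⟨Nat.find hex, hle, Nat.find_spec hex, fun s' hs' hp =>
        hw ((hp.tail e).mono (hs'.trans_le hle))⟩
    simp only [spread, Finset.mem_union, Finset.mem_sdiff, mem_reached]
    constructor
    · constructor
      · rintro (h | ⟨⟨h1, h2⟩, u, hu, e⟩)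
        · obtain ⟨s, hs, h⟩ := (ih v).1.1 h
          exact ⟨s, hs.trans (Nat.le_succ t), h⟩
        · exact ⟨t + 1, le_rfl, (sub1 u hu).tail e, fun s' hs' hp =>
            (cover v h1 h2).2 (hp.mono (Nat.lt_succ_iff.1 hs'))⟩
      · rintro ⟨s, hs, h, hmin⟩
        by_cases hv1 : v ∈ (spread g Sr Sp t).1
        · exact Or.inl hv1
        rcases Nat.le_succ_iff.1 hs with hs | rfl
        · exact Or.inl ((ih v).1.2 ⟨s, hs, h, hmin⟩)
        · have hp : ¬ ReachedWithin g Sp t v := hmin t (Nat.lt_succ_self t)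
          have hv2 : v ∉ (spread g Sr Sp t).2 := fun h => hp (sub2 v h)
          rcases ReachedWithin.succ_iff.1 h with h | ⟨u, h, e⟩
          · exact absurd h (cover v hv1 hv2).1
          · exact Or.inr ⟨⟨hv1, hv2⟩, u, carry u v h e hp, e⟩
    · constructor
      · rintro (h | ⟨⟨⟨h2, h1⟩, u, hu, e⟩, hnot⟩)
        · obtain ⟨s, hs, h⟩ := (ih v).2.1 h
          exact ⟨s, hs.trans (Nat.le_succ t), h⟩
        · refine ⟨t + 1, le_rfl, (sub2 u hu).tail e, fun hr => ?_⟩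
          rcases ReachedWithin.succ_iff.1 hr with hr | ⟨w, hw, e'⟩
          · exact (cover v h1 h2).1 hr
          · exact hnot ⟨⟨h1, h2⟩, w, carry w v hw e' (cover v h1 h2).2, e'⟩
      · rintro ⟨s, hs, h, hr⟩
        by_cases hv2 : v ∈ (spread g Sr Sp t).2
        · exact Or.inl hv2
        rcases Nat.le_succ_iff.1 hs with hs | rfl
        · exact Or.inl ((ih v).2.2 ⟨s, hs, h, hr⟩)
        · have hrt : ¬ ReachedWithin g Sr t v := fun h => hr (h.mono (Nat.le_succ t))
          have hv1 : v ∉ (spread g Sr Sp t).1 := fun h => hrt (sub1 v h)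
          rcases ReachedWithin.succ_iff.1 h with h | ⟨u, h, e⟩
          · exact absurd h (cover v hv1 hv2).2
          · have hu : ¬ ReachedWithin g Sr t u := fun h => hr (h.tail e)
            refine Or.inr ⟨⟨⟨hv2, hv1⟩, u, (ih u).2.2 ⟨t, le_rfl, h, hu⟩, e⟩, ?_⟩
            rintro ⟨-, w, hw, e'⟩
            exact hr ((sub1 w hw).tail e')

theorem acceptsRumor_iff (g : Finset (V × V)) (Sr Sp : Finset V) (v : V) :
    AcceptsRumor g Sr Sp v ↔
      ∃ t, ReachedWithin g Sr t v ∧ ∀ s < t, ¬ ReachedWithin g Sp s v := by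
  constructor
  · rintro ⟨t, ht⟩
    obtain ⟨s, -, h⟩ := (mem_spread g Sr Sp t v).1.1 ht
    exact ⟨s, h⟩
  · rintro ⟨t, ht⟩
    exact ⟨t, (mem_spread g Sr Sp t v).1.2 ⟨t, le_rfl, ht⟩⟩

theorem AcceptsRumor.anti {g : Finset (V × V)} {Sr A B : Finset V} {v : V} (hAB : A ⊆ B)
    (h : AcceptsRumor g Sr B v) : AcceptsRumor g Sr A v := by
  rw [acceptsRumor_iff] at h ⊢
  obtain ⟨t, ht, hs⟩ := h
  exact ⟨t, ht, fun s hst ⟨x, hx, hw⟩ => hs s hst ⟨x, hAB hx, hw⟩⟩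

theorem not_acceptsRumor_of_mem {g : Finset (V × V)} {Sr A : Finset V} {v : V} (hA : v ∈ A)
    (hr : v ∉ Sr) : ¬ AcceptsRumor g Sr A v := by
  rw [acceptsRumor_iff]
  rintro ⟨t, ht, hs⟩
  rcases Nat.eq_zero_or_pos t with rfl | hpos
  · exact hr (ReachedWithin.zero_iff.1 ht)
  · exact hs 0 hpos (ReachedWithin.zero_iff.2 hA)

/-- Loop invariant at level n: `vis` is the set of nodes at distance less than n to v, `vis ∪ cur`
the set at distance at most n, and no rumor seed lies at distance less than n. The right-hand side
is vacuous when no rumor seed reaches v, which matches returning the whole layer. -/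
theorem mem_rSamplingLoop (g : Finset (V × V)) (Sr : Finset V) (v x : V)
    (cur vis : Finset V) (h : Disjoint cur vis) (n : ℕ)
    (hvis : ∀ u, u ∈ vis ↔ ∃ s < n, Within g s u v)
    (hcur : ∀ u, u ∈ vis ∪ cur ↔ Within g n u v)
    (hSr : ∀ s < n, ¬ ReachedWithin g Sr s v) :
    x ∈ rSamplingLoop g Sr cur vis h ↔
      ∀ t, ReachedWithin g Sr t v → ∃ s < t, Within g s x v := by
  induction cur, vis, h using rSamplingLoop.induct g Sr generalizing n with
  | case1 vis h =>
    rw [rSamplingLoop]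
    simp only [↓reduceIte, Finset.mem_univ, true_iff]
    -- An empty level means that the backward ball has stopped growing, so every node that reaches v
    -- is already in `vis`, and none of these is a rumor seed.
    have hn : ∀ u, Within g n u v → ∃ s < n, Within g s u v := fun u hu =>
      (hvis u).1 (by simpa using (hcur u).2 hu)
    have hstay : ∀ t u, Within g t u v → ∃ s < n, Within g s u v := by
      intro t
      induction t with
      | zero => exact fun u hu => hn u (Within.mono (Nat.zero_le n) hu)
      | succ t ih =>
        intro u hu
        rcases Within.succ_iff_head.1 hu with hu | ⟨w, e, hu⟩
        · exact ih u hu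
        · obtain ⟨s, hs, hw⟩ := ih w hu
          exact hn u ((Within.head e hw).mono hs)
    rintro t ⟨y, hy, hw⟩
    obtain ⟨s, hs, hw⟩ := hstay t y hw
    exact absurd ⟨y, hy, hw⟩ (hSr s hs)
  | case2 cur vis h hne hmeet =>
    rw [rSamplingLoop, if_neg hne, if_pos hmeet, hvis]
    constructor
    · rintro ⟨s, hs, hw⟩ t ht
      have hnt : n ≤ t := not_lt.1 fun hlt => hSr t hlt ht
      exact ⟨s, hs.trans_le hnt, hw⟩
    · intro hx
      obtain ⟨y, hy⟩ := hmeet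
      rw [Finset.mem_inter] at hy
      exact hx n ⟨y, hy.2, (hcur y).1 (Finset.mem_union_right _ hy.1)⟩
  | case3 cur vis h hne hmeet ih =>
    rw [rSamplingLoop, if_neg hne, if_neg hmeet]
    refine ih (n + 1) ?_ ?_ ?_
    · intro u
      rw [hcur]
      exact ⟨fun hu => ⟨n, Nat.lt_succ_self n, hu⟩,
        fun ⟨s, hs, hu⟩ => hu.mono (Nat.lt_succ_iff.1 hs)⟩
    · intro u
      rw [Finset.mem_union, Finset.mem_filter, hcur, Within.succ_iff_head]
      simp only [Finset.mem_univ, true_and]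
      constructor
      · rintro (hu | ⟨-, w, hw, e⟩)
        · exact Or.inl hu
        · exact Or.inr ⟨w, e, (hcur w).1 (Finset.mem_union_right _ hw)⟩
      · intro hu
        by_cases hun : Within g n u v
        · exact Or.inl hun
        · rcases hu with hu | ⟨w, e, hw⟩
          · exact Or.inl hu
          · refine Or.inr ⟨hun, w, ?_, e⟩
            rcases Finset.mem_union.1 ((hcur w).2 hw) with hw | hw
            · obtain ⟨s, hs, hw⟩ := (hvis w).1 hw
              exact absurd ((Within.head e hw).mono hs) hun
            · exact hw
    · rintro s hs ⟨y, hy, hw⟩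
      rcases Finset.mem_union.1 ((hcur y).2 (hw.mono (Nat.lt_succ_iff.1 hs))) with hv | hc
      · obtain ⟨s', hs', hw'⟩ := (hvis y).1 hv
        exact hSr s' hs' ⟨y, hy, hw'⟩
      · exact hmeet ⟨y, Finset.mem_inter.2 ⟨hc, hy⟩⟩

theorem mem_rSampling (g : Finset (V × V)) (Sr : Finset V) (v x : V) :
    x ∈ rSampling g v Sr ↔ ∀ t, ReachedWithin g Sr t v → ∃ s < t, Within g s x v :=
  mem_rSamplingLoop g Sr v x _ _ _ 0 (by simp) (by simp [Within]) (by simp)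

/-- A nonempty positive seed set protects `v` exactly when it meets the R-sampling of `v`. -/
theorem inter_rSampling_nonempty_iff (g : Finset (V × V)) (Sr : Finset V) {S : Finset V}
    (hS : S.Nonempty) (v : V) :
    (S ∩ rSampling g v Sr).Nonempty ↔ ¬ AcceptsRumor g Sr S v := by
  rw [acceptsRumor_iff]
  constructor
  · rintro ⟨x, hx⟩ ⟨t, ht, hs⟩
    rw [Finset.mem_inter, mem_rSampling] at hx
    obtain ⟨s, hst, hw⟩ := hx.2 t ht
    exact hs s hst ⟨x, hx.1, hw⟩
  · intro h
    push Not at h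
    by_cases hex : ∃ t, ReachedWithin g Sr t v
    · classical
      obtain ⟨s, hs, x, hx, hw⟩ := h _ (Nat.find_spec hex)
      refine ⟨x, Finset.mem_inter.2 ⟨hx, (mem_rSampling g Sr v x).2 fun t ht => ?_⟩⟩
      exact ⟨s, hs.trans_le (Nat.find_min' hex ht), hw⟩
    -- Only here is S required to be nonempty: the rumor never reaches v, so v is spared, yet the
    -- empty set would not meet the sample.
    · obtain ⟨x, hx⟩ := hS
      exact ⟨x, Finset.mem_inter.2 ⟨hx, (mem_rSampling g Sr v x).2 fun t ht =>
        absurd ⟨t, ht⟩ hex⟩⟩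

end Diffusion

/-! ### Expectations over finite distributions -/

theorem PMF.sum_toReal_bind {α β : Type*} [Fintype α] [Fintype β] (p : PMF α) (q : α → PMF β)
    (f : β → ℝ) :
    ∑ b, (p.bind q b).toReal * f b = ∑ a, (p a).toReal * ∑ b, (q a b).toReal * f b := by
  have h : ∀ b, (p.bind q b).toReal = ∑ a, (p a).toReal * (q a b).toReal := by
    intro b
    rw [PMF.bind_apply, tsum_fintype, ENNReal.toReal_sum fun a _ =>
      ENNReal.mul_ne_top (p.apply_ne_top a) ((q a).apply_ne_top b)]
    simp
  simp only [h, Finset.sum_mul, Finset.mul_sum]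
  rw [Finset.sum_comm]
  simp only [mul_assoc]

theorem PMF.sum_toReal_map {α β : Type*} [Fintype α] [Fintype β] (p : PMF α) (φ : α → β)
    (f : β → ℝ) :
    ∑ b, (p.map φ b).toReal * f b = ∑ a, (p a).toReal * f (φ a) := by
  classical
  rw [PMF.map, PMF.sum_toReal_bind]
  refine Finset.sum_congr rfl fun a _ => ?_
  rw [Finset.sum_eq_single (φ a) (fun b _ hb => by simp [hb]) (by simp)]
  simp

/-- The marginal of a product weight. -/
theorem Fintype.sum_prod_mul_eval {ι α : Type*} [Fintype ι] [DecidableEq ι] [Fintype α]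
    (p : ι → α → ℝ) (hp : ∀ i, ∑ a, p i a = 1) (i : ι) (F : α → ℝ) :
    ∑ g : ι → α, (∏ j, p j (g j)) * F (g i) = ∑ a, p i a * F a := by
  -- F is absorbed into the i-th factor, so that the sum over g factors; all other factors sum to 1.
  have h := Finset.prod_univ_sum (fun _ : ι => (Finset.univ : Finset α))
    (fun j a => p j a * if j = i then F a else 1)
  rw [Fintype.piFinset_univ] at h
  have hl : ∏ j, ∑ a, p j a * (if j = i then F a else 1) = ∑ a, p i a * F a := by
    rw [Finset.prod_eq_single i]
    · simp
    · intro j _ hj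
      simp [hj, hp]
    · simp
  rw [← hl, h]
  refine Finset.sum_congr rfl fun g _ => ?_
  rw [Finset.prod_mul_distrib]
  congr 1
  simp

/-! ### The objective and its unbiased estimator -/

namespace RumorNetwork

variable {V : Type*} [Fintype V] [DecidableEq V] {r : ℕ}

open Classical in
/-- The indicator that the feature node `x` does not accept the rumor in the realization `h`. -/
noncomputable def spared (N : RumorNetwork V r) (S : Finset V) (x : V × Fin r)
    (h : Finset (V × V)) : ℝ :=
  if AcceptsRumor h (N.rumorLayer x.2) S x.1 then 0 else 1

theorem spared_nonneg (N : RumorNetwork V r) (S : Finset V) (x : V × Fin r)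
    (h : Finset (V × V)) : 0 ≤ N.spared S x h := by
  unfold spared; split_ifs <;> norm_num

theorem spared_le_one (N : RumorNetwork V r) (S : Finset V) (x : V × Fin r)
    (h : Finset (V × V)) : N.spared S x h ≤ 1 := by
  unfold spared; split_ifs <;> norm_num

theorem spared_mono (N : RumorNetwork V r) {A B : Finset V} (hAB : A ⊆ B) (x : V × Fin r)
    (h : Finset (V × V)) : N.spared A x h ≤ N.spared B x h := by
  unfold spared
  split_ifs with h1 h2 h2
  · exact le_rfl
  · norm_num
  · exact absurd (h2.anti hAB) h1
  · exact le_rfl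

omit [DecidableEq V] in
theorem integral_pi_indicator_le {c : ℝ} (hc : c ∈ Set.Icc (0 : ℝ) 1) (v : V) :
    ∫ τ : V → ℝ, (if τ v ≤ c then (1 : ℝ) else 0)
      ∂(Measure.pi fun _ : V => volume.restrict (Set.Icc (0 : ℝ) 1)) = c := by
  have : IsProbabilityMeasure (volume.restrict (Set.Icc (0 : ℝ) 1)) := ⟨by simp⟩
  have hmp := measurePreserving_eval (fun _ : V => volume.restrict (Set.Icc (0 : ℝ) 1)) v
  have hset : MeasurableSet (Set.Iic c) := measurableSet_Iic
  have h1 : (fun τ : V → ℝ => if τ v ≤ c then (1 : ℝ) else 0) =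
      (fun τ => (Set.Iic c).indicator (fun _ => (1 : ℝ)) (Function.eval v τ)) := by
    ext τ
    simp [Set.indicator]
  rw [h1, ← integral_map hmp.measurable.aemeasurable
    (f := (Set.Iic c).indicator fun _ => (1 : ℝ))
    ((measurable_const.indicator hset).aestronglyMeasurable), hmp.map_eq,
    integral_indicator_const _ hset, measureReal_restrict_apply hset]
  have h2 : Set.Iic c ∩ Set.Icc 0 1 = Set.Icc 0 c := by
    ext x
    simp only [Set.mem_inter_iff, Set.mem_Iic, Set.mem_Icc]
    exact ⟨fun h => ⟨h.2.1, h.1⟩, fun h => ⟨h.2, h.1, h.2.trans hc.2⟩⟩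
  rw [h2]
  simp [hc.1]

theorem integral_numNotRumorActive (N : RumorNetwork V r) (S : Finset V)
    (g : Fin r → Finset (V × V)) :
    ∫ τ, (N.numNotRumorActive S g τ : ℝ)
      ∂(Measure.pi fun _ : V => volume.restrict (Set.Icc (0 : ℝ) 1)) =
    ∑ v, ∑ i, N.weight i * N.spared S (v, i) (g i) := by
  have : IsProbabilityMeasure (volume.restrict (Set.Icc (0 : ℝ) 1)) := ⟨by simp⟩
  -- The spared weight lies in [0, 1], so a uniform threshold falls below it with probability equal
  -- to that weight.
  have hc : ∀ v, ∑ i, N.weight i * N.spared S (v, i) (g i) ∈ Set.Icc (0 : ℝ) 1 := fun v =>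
    ⟨Finset.sum_nonneg fun i _ => mul_nonneg (N.weight_nonneg i) (N.spared_nonneg _ _ _), by
      rw [← N.weight_sum]
      exact Finset.sum_le_sum fun i _ =>
        mul_le_of_le_one_right (N.weight_nonneg i) (N.spared_le_one _ _ _)⟩
  have h : ∀ τ, (N.numNotRumorActive S g τ : ℝ) =
      ∑ v, if τ v ≤ ∑ i, N.weight i * N.spared S (v, i) (g i) then (1 : ℝ) else 0 := by
    intro τ
    rw [numNotRumorActive, Finset.card_filter]
    push_cast
    refine Finset.sum_congr rfl fun v _ => ?_
    have : ∀ i, N.spared S (v, i) (g i) = 1 - @ite ℝ (AcceptsRumor (g i) (N.rumorLayer i) S v)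
        (Classical.propDecidable _) 1 0 := by
      intro i
      unfold spared
      split_ifs <;> norm_num
    simp only [this]
  simp only [h]
  rw [integral_finsetSum]
  · exact Finset.sum_congr rfl fun v _ => integral_pi_indicator_le (hc v) v
  · intro v _
    refine Integrable.of_mem_Icc 0 1 ?_ (Filter.Eventually.of_forall fun τ => ?_)
    · exact (Measurable.ite (measurableSet_le (measurable_pi_apply v) measurable_const)
        measurable_const measurable_const).aemeasurable
    · split_ifs <;> simp

/-- The objective is the weighted expected number of feature nodes that do not accept the rumor. -/
theorem objective_eq (N : RumorNetwork V r) (S : Finset V) :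
    N.objective S = ∑ x : V × Fin r,
      N.weight x.2 * ∑ h, N.realizationProb x.2 h * N.spared S x h := by
  unfold objective
  simp only [integral_numNotRumorActive, Fintype.sum_prod_type, Finset.mul_sum]
  rw [Finset.sum_comm]
  refine Finset.sum_congr rfl fun v _ => ?_
  rw [Finset.sum_comm]
  refine Finset.sum_congr rfl fun i _ => ?_
  have := Fintype.sum_prod_mul_eval N.realizationProb N.sum_realizationProb i
    (fun h => N.weight i * N.spared S (v, i) h)
  rw [this]
  exact Finset.sum_congr rfl fun h _ => by ring

theorem objective_mono (N : RumorNetwork V r) {A B : Finset V} (hAB : A ⊆ B) :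
    N.objective A ≤ N.objective B := by
  rw [objective_eq, objective_eq]
  exact Finset.sum_le_sum fun x _ => mul_le_mul_of_nonneg_left
    (Finset.sum_le_sum fun h _ => mul_le_mul_of_nonneg_left (N.spared_mono hAB x h)
      (N.realizationProb_nonneg _ _)) (N.weight_nonneg _)

theorem objective_pos (N : RumorNetwork V r) {S : Finset V} {v : V} (hv : v ∈ S)
    (hr : v ∉ N.rumorSeeds) : 0 < N.objective S := by
  have hsp : ∀ i h, N.spared S (v, i) h = 1 := fun i h =>
    if_neg (not_acceptsRumor_of_mem hv fun hm => hr (N.rumorLayer_subset i hm))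
  have hnn : ∀ x : V × Fin r,
      0 ≤ N.weight x.2 * ∑ h, N.realizationProb x.2 h * N.spared S x h := fun x =>
    mul_nonneg (N.weight_nonneg _) (Finset.sum_nonneg fun h _ =>
      mul_nonneg (N.realizationProb_nonneg _ _) (N.spared_nonneg _ _ _))
  rw [objective_eq, Fintype.sum_prod_type]
  -- The seed v alone contributes the total weight 1, being spared in every layer.
  refine lt_of_lt_of_le one_pos ?_
  refine le_trans ?_ (Finset.single_le_sum
    (fun u _ => Finset.sum_nonneg fun i _ => hnn (u, i)) (Finset.mem_univ v))
  simp only [hsp, mul_one, N.sum_realizationProb, N.weight_sum, le_refl]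

theorem mem_feasible {N : RumorNetwork V r} {k : ℕ} {S : Finset V} :
    S ∈ N.feasible k ↔ Disjoint S N.rumorSeeds ∧ S.card ≤ k := by
  simp [feasible]

/-- The optimum is positive and attained by a nonempty feasible set. -/
theorem exists_nonempty_optimal (N : RumorNetwork V r) {k : ℕ} (hk : 1 ≤ k)
    (hkn : k + N.rumorSeeds.card ≤ Fintype.card V) :
    ∃ S ∈ N.feasible k, S.Nonempty ∧ N.objective S = N.opt k ∧ 0 < N.opt k := by
  obtain ⟨u, hu⟩ : ∃ u, u ∉ N.rumorSeeds := by
    by_contra! h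
    have : N.rumorSeeds = Finset.univ := Finset.eq_univ_iff_forall.2 h
    rw [this, Finset.card_univ] at hkn
    omega
  have huf : {u} ∈ N.feasible k := mem_feasible.2 ⟨by simpa using hu, by simpa using hk⟩
  have hle : ∀ S ∈ N.feasible k, N.objective S ≤ N.opt k := fun S hS => Finset.le_sup' _ hS
  have hpos : 0 < N.opt k :=
    (N.objective_pos (Finset.mem_singleton_self u) hu).trans_le (hle _ huf)
  obtain ⟨S, hS, hopt⟩ := Finset.exists_mem_eq_sup' (s := N.feasible k) ⟨_, huf⟩ N.objective
  change N.opt k = _ at hopt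
  -- If the empty set is optimal, monotonicity makes a singleton optimal as well; the estimator is
  -- unbiased only for nonempty sets.
  rcases S.eq_empty_or_nonempty with rfl | hne
  · exact ⟨{u}, huf, Finset.singleton_nonempty u,
      le_antisymm (hle _ huf) (hopt ▸ N.objective_mono (Finset.empty_subset _)), hpos⟩
  · exact ⟨S, hS, hne, hopt.symm, hpos⟩

/-- The weight of the layers in which the sample `R` is covered by `S`. -/
noncomputable def coveredWeight (N : RumorNetwork V r) (S : Finset V)
    (R : Finset (V × Fin r)) : ℝ :=
  ∑ i, N.weight i * covered S i R

omit [Fintype V] in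
theorem coverage_eq (N : RumorNetwork V r) {θ : ℕ} (R : Fin θ → Finset (V × Fin r))
    (S : Finset V) : N.coverage R S = 1 / (θ : ℝ) * ∑ j, N.coveredWeight S (R j) := by
  unfold coverage coveredWeight
  rw [Finset.sum_comm]
  simp only [Finset.mul_sum]

omit [Fintype V] in
theorem covered_image (S T : Finset V) (i l : Fin r) :
    covered S i (T.image fun v => (v, l)) = if i = l ∧ (S ∩ T).Nonempty then 1 else 0 := by
  unfold covered
  congr 1
  refine propext ⟨?_, ?_⟩
  · rintro ⟨x, hx⟩
    simp only [Finset.mem_inter, Finset.mem_image] at hx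
    obtain ⟨⟨a, ha, rfl⟩, b, hb, hba⟩ := hx
    obtain ⟨rfl, rfl⟩ := Prod.mk.inj hba
    exact ⟨rfl, b, Finset.mem_inter.2 ⟨ha, hb⟩⟩
  · rintro ⟨rfl, a, ha⟩
    rw [Finset.mem_inter] at ha
    exact ⟨(a, i), by simp [ha.1, ha.2]⟩

omit [Fintype V] in
theorem coveredWeight_image (N : RumorNetwork V r) (S T : Finset V) (l : Fin r) :
    N.coveredWeight S (T.image fun v => (v, l)) =
      N.weight l * if (S ∩ T).Nonempty then 1 else 0 := by
  unfold coveredWeight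
  simp only [covered_image]
  rw [Finset.sum_eq_single l (fun i _ hi => by simp [hi]) (by simp)]
  simp

variable [Nonempty V] [NeZero r]

omit [Nonempty V] [Fintype V] in
theorem weight_le_maxWeight (N : RumorNetwork V r) (i : Fin r) : N.weight i ≤ N.maxWeight :=
  Finset.le_sup' N.weight (Finset.mem_univ i)

omit [Nonempty V] [Fintype V] in
theorem maxWeight_pos (N : RumorNetwork V r) : 0 < N.maxWeight := by
  by_contra! h
  have h0 : ∑ i, N.weight i ≤ 0 :=
    Finset.sum_nonpos fun i _ => (N.weight_le_maxWeight i).trans h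
  rw [N.weight_sum] at h0
  linarith

omit [Nonempty V] [Fintype V] in
theorem maxWeight_le_one (N : RumorNetwork V r) : N.maxWeight ≤ 1 := by
  refine Finset.sup'_le _ _ fun i _ => ?_
  rw [← N.weight_sum]
  exact Finset.single_le_sum (fun j _ => N.weight_nonneg j) (Finset.mem_univ i)

/-- Almost surely only: a set of feature nodes spread over several layers could collect more than
the maximum weight, but samples in the support lie in one layer. This is the source of w̄ in the
sample bounds. -/
theorem coveredWeight_mem_Icc (N : RumorNetwork V r) (S : Finset V) :
    ∀ᵐ R ∂N.multiSampling.toMeasure, N.coveredWeight S R ∈ Set.Icc 0 N.maxWeight := by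
  rw [ae_iff, PMF.toMeasure_apply_eq_zero_iff _ (Set.toFinite _).measurableSet,
    Set.disjoint_left]
  intro R hR
  obtain ⟨x, -, hR⟩ := (PMF.mem_support_bind_iff _ _ _).1 hR
  obtain ⟨g, -, rfl⟩ := (PMF.mem_support_map_iff _ _ _).1 hR
  simp only [Set.mem_ofPred_eq, not_not, coveredWeight_image]
  have h0 := N.weight_nonneg x.2
  have h1 := N.weight_le_maxWeight x.2
  split_ifs <;> simp only [mul_one, mul_zero, Set.mem_Icc]
  · exact ⟨h0, h1⟩
  · exact ⟨le_rfl, h0.trans h1⟩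

/-- Multi-Sampling gives an unbiased estimator of the objective of a nonempty seed set. -/
theorem integral_coveredWeight (N : RumorNetwork V r) {S : Finset V} (hS : S.Nonempty) :
    ∫ R, N.coveredWeight S R ∂N.multiSampling.toMeasure =
      N.objective S / (Fintype.card V * r) := by
  rw [PMF.integral_eq_sum]
  simp only [smul_eq_mul]
  rw [multiSampling, PMF.sum_toReal_bind, objective_eq, Finset.sum_div]
  refine Finset.sum_congr rfl fun x _ => ?_
  rw [PMF.sum_toReal_map]
  have hsp : ∀ g, (if (S ∩ rSampling g x.1 (N.rumorLayer x.2)).Nonempty then (1 : ℝ) else 0) =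
      N.spared S x g := by
    intro g
    unfold spared
    have hiff := inter_rSampling_nonempty_iff g (N.rumorLayer x.2) hS x.1
    by_cases h : AcceptsRumor g (N.rumorLayer x.2) S x.1
    · rw [if_pos h, if_neg fun h' => hiff.1 h' h]
    · rw [if_neg h, if_pos (hiff.2 h)]
  have hp : ∀ g, (N.realization x.2 g).toReal = N.realizationProb x.2 g := fun g =>
    ENNReal.toReal_ofReal (N.realizationProb_nonneg _ _)
  simp only [coveredWeight_image, hsp, hp, PMF.uniformOfFintype_apply, Fintype.card_prod,
    Fintype.card_fin]
  rw [ENNReal.toReal_inv]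
  push_cast
  simp only [ENNReal.toReal_mul, ENNReal.toReal_natCast]
  rw [div_eq_inv_mul, Finset.mul_sum (a := N.weight x.2)]
  congr 1
  exact Finset.sum_congr rfl fun g _ => by ring

end RumorNetwork

/-! ### Exponential inequalities and tail bounds -/

/-- It follows from (1 + x + x²/2)(1 - x + x²/2) = 1 + x⁴/4 ≥ 1 and the quadratic lower bound for
exp x. -/
theorem Real.exp_neg_le_quadratic {x : ℝ} (hx : 0 ≤ x) : Real.exp (-x) ≤ 1 - x + x ^ 2 / 2 := by
  have h := Real.quadratic_le_exp_of_nonneg hx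
  have hq : 0 < 1 + x + x ^ 2 / 2 := by positivity
  rw [Real.exp_neg]
  refine (inv_anti₀ hq h).trans ?_
  rw [inv_le_iff_one_le_mul₀ hq]
  nlinarith [sq_nonneg (x ^ 2)]

/-- Clearing denominators, the claim is exp(-x)(x² + 4x + 6) + 2x ≥ 6. Equality holds at 0, and the
left side is increasing, again by exp x ≥ 1 + x + x²/2. -/
theorem Real.exp_le_bernstein {x : ℝ} (hx : 0 ≤ x) (hx3 : x < 3) :
    Real.exp x ≤ 1 + x + x ^ 2 / (2 * (1 - x / 3)) := by
  have hmono : MonotoneOn (fun y : ℝ => Real.exp (-y) * (y ^ 2 + 4 * y + 6) + 2 * y)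
      (Set.Ici 0) := by
    have hd : ∀ y : ℝ, HasDerivAt (fun y : ℝ => Real.exp (-y) * (y ^ 2 + 4 * y + 6) + 2 * y)
        (2 - Real.exp (-y) * (y ^ 2 + 2 * y + 2)) y := by
      intro y
      have h1 : HasDerivAt (fun y : ℝ => Real.exp (-y)) (Real.exp (-y) * (-1)) y :=
        (hasDerivAt_neg y).exp
      have h2 : HasDerivAt (fun y : ℝ => y ^ 2 + 4 * y + 6) (2 * y + 4) y := by
        simpa using (((hasDerivAt_pow 2 y).add ((hasDerivAt_id y).const_mul 4)).add_const 6)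
      have h3 : HasDerivAt (fun y : ℝ => 2 * y) 2 y := by
        simpa using (hasDerivAt_id y).const_mul 2
      exact ((h1.mul h2).add h3).congr_deriv (by ring)
    refine monotoneOn_of_deriv_nonneg (convex_Ici 0)
      (fun y _ => (hd y).continuousAt.continuousWithinAt)
      (fun y _ => (hd y).differentiableAt.differentiableWithinAt) ?_
    intro y hy
    rw [interior_Ici, Set.mem_Ioi] at hy
    rw [(hd y).deriv, Real.exp_neg, sub_nonneg, inv_mul_le_iff₀ (Real.exp_pos y)]
    linarith [Real.quadratic_le_exp_of_nonneg hy.le]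
  have h := hmono (Set.mem_Ici.2 le_rfl) (Set.mem_Ici.2 hx) hx
  simp only [neg_zero, Real.exp_zero] at h
  have hpos : 0 < 3 - x := by linarith
  have he : (1 + x + x ^ 2 / (2 * (1 - x / 3))) = (x ^ 2 + 4 * x + 6) / (2 * (3 - x)) := by
    have : 1 - x / 3 ≠ 0 := by intro h0; linarith
    field_simp
    ring
  rw [he, le_div_iff₀ (by linarith)]
  have hm : Real.exp x * (6 - 2 * x) ≤ Real.exp x * (Real.exp (-x) * (x ^ 2 + 4 * x + 6)) :=
    mul_le_mul_of_nonneg_left (by linarith) (Real.exp_pos x).le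
  rw [← mul_assoc, ← Real.exp_add, add_neg_cancel, Real.exp_zero, one_mul] at hm
  linarith

section Concentration

variable {Ω : Type*} [MeasurableSpace Ω] {P : Measure Ω} [IsProbabilityMeasure P]

theorem integrable_of_mem_Icc {X : Ω → ℝ} (hX : AEMeasurable X P) {b : ℝ}
    (h : ∀ᵐ ω ∂P, X ω ∈ Set.Icc 0 b) : Integrable X P :=
  Integrable.of_mem_Icc 0 b hX h

/-- Moment generating function bound for a variable with values in `[0, b]` and a quadratic
upper bound of the exponential along `t * [0, b]`. -/
theorem mgf_le_of_quadratic {X : Ω → ℝ} (hX : AEMeasurable X P) {b : ℝ}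
    (h : ∀ᵐ ω ∂P, X ω ∈ Set.Icc 0 b) {t c : ℝ} (hc : 0 ≤ c)
    (hexp : ∀ x ∈ Set.Icc 0 b, Real.exp (t * x) ≤ 1 + t * x + c * x ^ 2) :
    mgf X P t ≤ Real.exp ((t + c * b) * ∫ ω, X ω ∂P) := by
  have hint := integrable_of_mem_Icc hX h
  have h1 : mgf X P t ≤ ∫ ω, (1 + (t + c * b) * X ω) ∂P := by
    refine integral_mono_of_nonneg (Filter.Eventually.of_forall fun ω => (Real.exp_pos _).le)
      ((integrable_const _).add (hint.const_mul _)) ?_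
    filter_upwards [h] with ω hx
    -- The second moment is controlled by b times the mean, so no variance is needed.
    have hsq : X ω ^ 2 ≤ b * X ω := by nlinarith [hx.1, hx.2]
    have := hexp _ hx
    have := mul_le_mul_of_nonneg_left hsq hc
    linarith
  rw [integral_add (integrable_const _) (hint.const_mul _), integral_const_mul] at h1
  simp only [integral_const, probReal_univ, smul_eq_mul, mul_one] at h1
  linarith [Real.add_one_le_exp ((t + c * b) * ∫ ω, X ω ∂P)]

variable {m : ℕ} {X : Fin m → Ω → ℝ}

omit [IsProbabilityMeasure P] in
theorem mgf_sum_le (hX : ∀ j, AEMeasurable (X j) P) (hind : iIndepFun X P) {t B : ℝ}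
    (hB : ∀ j, mgf (X j) P t ≤ Real.exp B) :
    mgf (fun ω => ∑ j, X j ω) P t ≤ Real.exp (m * B) := by
  have h : (fun ω => ∑ j, X j ω) = ∑ j, X j := by ext ω; simp
  rw [h, hind.mgf_sum₀ hX, Real.exp_nat_mul]
  calc ∏ j, mgf (X j) P t ≤ ∏ _j : Fin m, Real.exp B :=
        Finset.prod_le_prod (fun j _ => mgf_nonneg) fun j _ => hB j
    _ = Real.exp B ^ m := by simp

theorem integrable_exp_mul_sum (hX : ∀ j, AEMeasurable (X j) P) {b : ℝ}
    (h : ∀ j, ∀ᵐ ω ∂P, X j ω ∈ Set.Icc 0 b) (t : ℝ) :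
    Integrable (fun ω => Real.exp (t * ∑ j, X j ω)) P := by
  refine integrable_exp_mul_of_mem_Icc (a := 0) (b := m * b)
    (Finset.aemeasurable_fun_sum _ fun j _ => hX j) ?_
  filter_upwards [ae_all_iff.2 h] with ω hω
  refine ⟨Finset.sum_nonneg fun j _ => (hω j).1, ?_⟩
  calc ∑ j, X j ω ≤ ∑ _j : Fin m, b := Finset.sum_le_sum fun j _ => (hω j).2
    _ = m * b := by simp

/-- Multiplicative Chernoff bound for the lower tail of a sum of independent variables with values
in `[0, b]`. -/
theorem chernoff_lower_tail (hX : ∀ j, AEMeasurable (X j) P) (hind : iIndepFun X P) {b μ ε : ℝ}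
    (hb : 0 < b) (hε : 0 < ε) (h : ∀ j, ∀ᵐ ω ∂P, X j ω ∈ Set.Icc 0 b) (hμ : ∀ j, ∫ ω, X j ω ∂P = μ) :
    P.real {ω | ∑ j, X j ω ≤ (1 - ε) * (m * μ)} ≤ Real.exp (-(m * (ε ^ 2 * μ / (2 * b)))) := by
  -- The parameter t = -ε/b minimizes the exponent tεμ + t²bμ/2.
  have hs : 0 < ε / b := div_pos hε hb
  refine (measure_le_le_exp_mul_mgf _ (neg_nonpos.2 hs.le)
    (integrable_exp_mul_sum hX h _)).trans ?_
  have hm := mgf_sum_le (t := -(ε / b)) hX hind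
    (B := (-(ε / b) + (ε / b) ^ 2 / 2 * b) * μ) fun j => by
      rw [← hμ j]
      refine mgf_le_of_quadratic (hX j) (h j) (by positivity) fun x hx => ?_
      have := Real.exp_neg_le_quadratic (mul_nonneg hs.le hx.1)
      rw [neg_mul]
      refine this.trans_eq ?_
      ring
  refine (mul_le_mul_of_nonneg_left hm (Real.exp_pos _).le).trans_eq ?_
  rw [← Real.exp_add]
  congr 1
  field_simp
  ring

/-- Bernstein bound for the upper tail of a sum of independent variables with values in
`[0, b]`, where `b ≤ 1`. -/
theorem bernstein_upper_tail (hX : ∀ j, AEMeasurable (X j) P) (hind : iIndepFun X P)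
    {b μ ν ε : ℝ} (hb : 0 < b) (hb1 : b ≤ 1) (hε : 0 < ε) (h : ∀ j, ∀ᵐ ω ∂P, X j ω ∈ Set.Icc 0 b)
    (hμ : ∀ j, ∫ ω, X j ω ∂P = μ) (hμν : μ ≤ ν) :
    P.real {ω | m * (μ + ε * ν) ≤ ∑ j, X j ω} ≤
      Real.exp (-(m * (ε ^ 2 * ν / (2 * b + 2 / 3 * ε)))) := by
  have hd : 0 < b + ε / 3 := by positivity
  -- The usual Bernstein parameter: 1 - s/3 = b/(b + ε/3) gives cb = sε/2, and s < 3.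
  set s := ε / (b + ε / 3) with hs_def
  have hs : 0 < s := div_pos hε hd
  have hs3 : 1 - s / 3 = b / (b + ε / 3) := by rw [hs_def]; field_simp; ring
  have hs3pos : 0 < 1 - s / 3 := by rw [hs3]; positivity
  set c := s ^ 2 / (2 * (1 - s / 3)) with hc_def
  have hc : 0 ≤ c := by positivity
  refine (measure_ge_le_exp_mul_mgf _ hs.le (integrable_exp_mul_sum hX h _)).trans ?_
  have hm := mgf_sum_le (t := s) hX hind (B := (s + c * b) * μ) fun j => by
      rw [← hμ j]
      refine mgf_le_of_quadratic (hX j) (h j) hc fun x hx => ?_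
      have hx1 : x ≤ 1 := hx.2.trans hb1
      have hsx : s * x ≤ s := mul_le_of_le_one_right hs.le hx1
      refine (Real.exp_le_bernstein (mul_nonneg hs.le hx.1) (by linarith)).trans ?_
      have : (s * x) ^ 2 / (2 * (1 - s * x / 3)) ≤ (s * x) ^ 2 / (2 * (1 - s / 3)) := by
        gcongr
      have e : (s * x) ^ 2 / (2 * (1 - s / 3)) = c * x ^ 2 := by rw [hc_def]; ring
      linarith
  refine (mul_le_mul_of_nonneg_left hm (Real.exp_pos _).le).trans ?_
  rw [← Real.exp_add, Real.exp_le_exp]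
  have hcb : c * b = ε ^ 2 / (2 * (b + ε / 3)) := by
    rw [hc_def, hs3, hs_def]
    field_simp
  -- The terms in sμ cancel, and μ survives only in cbμ, where ν may replace it.
  have key : -s * (m * (μ + ε * ν)) + m * ((s + c * b) * μ) ≤
      m * (c * b * ν - s * ε * ν) := by
    have : c * b * μ ≤ c * b * ν := mul_le_mul_of_nonneg_left hμν (by positivity)
    have := mul_le_mul_of_nonneg_left this (Nat.cast_nonneg (α := ℝ) m)
    linarith
  refine key.trans_eq ?_
  rw [hcb, hs_def]
  field_simp
  ring

end Concentration

/-! ### Submodular coverage and greedy selection -/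

namespace RumorNetwork

variable {V : Type*} [DecidableEq V] {r : ℕ}

theorem covered_mono {A B : Finset V} (hAB : A ⊆ B) (i : Fin r) (R : Finset (V × Fin r)) :
    covered A i R ≤ covered B i R := by
  unfold covered
  split_ifs with h1 h2 h2
  · exact le_rfl
  · exact absurd (h1.mono (Finset.inter_subset_inter_right (Finset.image_subset_image hAB))) h2
  · norm_num
  · exact le_rfl

/-- The left side is positive only if T meets R and S does not; then some u in T \ S meets R, and
its term alone is 1. -/
theorem covered_sub_le_sum (S T : Finset V) (i : Fin r) (R : Finset (V × Fin r)) :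
    covered T i R - covered S i R ≤
      ∑ u ∈ T \ S, (covered (insert u S) i R - covered S i R) := by
  have hnn : ∀ u ∈ T \ S, 0 ≤ covered (insert u S) i R - covered S i R := fun u _ =>
    sub_nonneg.2 (covered_mono (Finset.subset_insert u S) i R)
  by_cases hle : covered T i R ≤ covered S i R
  · exact (sub_nonpos.2 hle).trans (Finset.sum_nonneg hnn)
  · have hT : ((T.image fun v => (v, i)) ∩ R).Nonempty := by
      by_contra h
      apply hle
      unfold covered
      rw [if_neg h]
      split_ifs <;> norm_num
    have hS : ¬ ((S.image fun v => (v, i)) ∩ R).Nonempty := by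
      intro h
      apply hle
      unfold covered
      rw [if_pos h]
      split_ifs <;> norm_num
    obtain ⟨x, hx⟩ := hT
    simp only [Finset.mem_inter, Finset.mem_image] at hx
    obtain ⟨⟨u, hu, rfl⟩, hR⟩ := hx
    have huS : u ∉ S := fun h =>
      hS ⟨(u, i), Finset.mem_inter.2 ⟨Finset.mem_image_of_mem _ h, hR⟩⟩
    have hins : ((insert u S).image (fun v => (v, i)) ∩ R).Nonempty :=
      ⟨(u, i), Finset.mem_inter.2
        ⟨Finset.mem_image_of_mem _ (Finset.mem_insert_self u S), hR⟩⟩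
    have hcT : covered T i R ≤ covered (insert u S) i R := by
      unfold covered
      rw [if_pos hins]
      split_ifs <;> norm_num
    exact (sub_le_sub_right hcT _).trans
      (Finset.single_le_sum hnn (Finset.mem_sdiff.2 ⟨hu, huS⟩))

variable (N : RumorNetwork V r) {θ : ℕ} (R : Fin θ → Finset (V × Fin r))

theorem coverage_mono {A B : Finset V} (hAB : A ⊆ B) : N.coverage R A ≤ N.coverage R B :=
  mul_le_mul_of_nonneg_left (Finset.sum_le_sum fun i _ => mul_le_mul_of_nonneg_left
    (Finset.sum_le_sum fun _ _ => covered_mono hAB i _) (N.weight_nonneg i)) (by positivity)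

theorem coverage_empty : N.coverage R ∅ = 0 := by
  simp [coverage, covered]

/-- Submodularity of the coverage. -/
theorem coverage_sub_le_sum (S T : Finset V) :
    N.coverage R T - N.coverage R S ≤
      ∑ u ∈ T \ S, (N.coverage R (insert u S) - N.coverage R S) := by
  have h : ∀ A, N.coverage R A =
      ∑ p : Fin r × Fin θ, 1 / (θ : ℝ) * N.weight p.1 * covered A p.1 (R p.2) := by
    intro A
    simp only [coverage, Finset.mul_sum, mul_assoc, Fintype.sum_prod_type]
  have hsub : ∀ A, N.coverage R A - N.coverage R S = ∑ p : Fin r × Fin θ,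
      1 / (θ : ℝ) * N.weight p.1 * (covered A p.1 (R p.2) - covered S p.1 (R p.2)) := by
    intro A
    rw [h, h, ← Finset.sum_sub_distrib]
    exact Finset.sum_congr rfl fun p _ => (mul_sub _ _ _).symm
  simp only [hsub]
  rw [Finset.sum_comm]
  refine Finset.sum_le_sum fun p _ => ?_
  rw [← Finset.mul_sum]
  exact mul_le_mul_of_nonneg_left (covered_sub_le_sum S T p.1 (R p.2))
    (mul_nonneg (by positivity) (N.weight_nonneg p.1))

variable {N R}

theorem NodeSelection.disjoint_and_card {j : ℕ} {S : Finset V} (h : N.NodeSelection R j S) :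
    Disjoint S N.rumorSeeds ∧ S.card = j := by
  induction h with
  | init => simp
  | step _ hu _ ih =>
    exact ⟨Finset.disjoint_insert_left.2 ⟨hu.1, ih.1⟩, by
      rw [Finset.card_insert_of_notMem hu.2, ih.2]⟩

/-- By submodularity the at most k users of T \ S together gain at least the gap to T, so the best
user gains a 1/k share of it. Each round thus shrinks the gap by the factor 1 - 1/k. -/
theorem NodeSelection.sub_coverage_le {k : ℕ} (hk : 1 ≤ k) {T : Finset V}
    (hT : Disjoint T N.rumorSeeds) (hTk : T.card ≤ k) {j : ℕ} {S : Finset V}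
    (h : N.NodeSelection R j S) :
    N.coverage R T - N.coverage R S ≤ (1 - 1 / (k : ℝ)) ^ j * N.coverage R T := by
  have hk0 : (0 : ℝ) < k := by exact_mod_cast hk
  have hk1 : 1 / (k : ℝ) ≤ 1 := by
    rw [div_le_one hk0]; exact_mod_cast hk
  induction h with
  | init => simp [coverage_empty]
  | @step j S u _ hu hmax ih =>
    set gain := N.coverage R (insert u S) - N.coverage R S with hgain
    have hg0 : 0 ≤ gain := sub_nonneg.2 (N.coverage_mono R (Finset.subset_insert u S))
    have hsum : N.coverage R T - N.coverage R S ≤ k * gain := by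
      refine (N.coverage_sub_le_sum R S T).trans ?_
      refine (Finset.sum_le_card_nsmul _ _ gain fun u' hu' => ?_).trans ?_
      · rw [Finset.mem_sdiff] at hu'
        exact hmax u' ⟨Finset.disjoint_left.1 hT hu'.1, hu'.2⟩
      · rw [nsmul_eq_mul]
        refine mul_le_mul_of_nonneg_right ?_ hg0
        exact_mod_cast (Finset.card_le_card Finset.sdiff_subset).trans hTk
    have hdiv : 1 / (k : ℝ) * (N.coverage R T - N.coverage R S) ≤ gain := by
      rw [one_div_mul_eq_div, div_le_iff₀ hk0]
      linarith
    calc N.coverage R T - N.coverage R (insert u S)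
        ≤ (1 - 1 / (k : ℝ)) * (N.coverage R T - N.coverage R S) := by linarith
      _ ≤ (1 - 1 / (k : ℝ)) * ((1 - 1 / (k : ℝ)) ^ j * N.coverage R T) :=
          mul_le_mul_of_nonneg_left ih (by linarith)
      _ = (1 - 1 / (k : ℝ)) ^ (j + 1) * N.coverage R T := by ring

/-- The greedy guarantee for the coverage. -/
theorem NodeSelection.le_coverage {k : ℕ} (hk : 1 ≤ k) {S T : Finset V}
    (hT : Disjoint T N.rumorSeeds) (hTk : T.card ≤ k) (h : N.NodeSelection R k S) :
    (1 - 1 / Real.exp 1) * N.coverage R T ≤ N.coverage R S := by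
  have h1 := h.sub_coverage_le hk hT hTk
  have hexp : (1 - 1 / (k : ℝ)) ^ k ≤ 1 / Real.exp 1 := by
    have := Real.one_sub_div_pow_le_exp_neg (n := k) (t := 1) (by exact_mod_cast hk)
    rwa [Real.exp_neg, ← one_div] at this
  have h0 : 0 ≤ N.coverage R T :=
    (N.coverage_empty R).symm.le.trans (N.coverage_mono R (Finset.empty_subset T))
  have := mul_le_mul_of_nonneg_right hexp h0
  linarith

variable [Fintype V]

/-- Fewer than n - n_r users are chosen before each round, so a candidate remains. This keeps the
final guarantee over all greedy outputs from being vacuous. -/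
theorem exists_nodeSelection {k : ℕ} (hkn : k + N.rumorSeeds.card ≤ Fintype.card V) :
    ∃ S, N.NodeSelection R k S := by
  induction k with
  | zero => exact ⟨∅, .init⟩
  | succ k ih =>
    obtain ⟨S, hS⟩ := ih (by omega)
    have hne : (Finset.univ \ (N.rumorSeeds ∪ S)).Nonempty := by
      rw [← Finset.card_pos, Finset.card_sdiff_of_subset (Finset.subset_univ _),
        Finset.card_univ]
      have := Finset.card_union_le N.rumorSeeds S
      rw [hS.disjoint_and_card.2] at this
      omega
    have hmem : ∀ u, u ∈ Finset.univ \ (N.rumorSeeds ∪ S) ↔ u ∉ N.rumorSeeds ∧ u ∉ S := by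
      intro u; simp
    obtain ⟨u, hu, hmax⟩ := Finset.exists_max_image _
      (fun u => N.coverage R (insert u S) - N.coverage R S) hne
    exact ⟨insert u S, .step hS ((hmem u).1 hu) fun u' hu' => hmax u' ((hmem u').2 hu')⟩

end RumorNetwork

/-! ### Sample sizes and the approximation guarantee -/

theorem Real.exp_neg_le_of_log_le {x δ : ℝ} (hδ : 0 < δ) (h : Real.log (1 / δ) ≤ x) :
    Real.exp (-x) ≤ δ := by
  rw [one_div, Real.log_inv] at h
  calc Real.exp (-x) ≤ Real.exp (Real.log δ) := Real.exp_le_exp.2 (by linarith)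
    _ = δ := Real.exp_log hδ

namespace RumorNetwork

variable {V : Type*} [Fintype V] [DecidableEq V] [Nonempty V] {r : ℕ} [NeZero r]
  {N : RumorNetwork V r} {θ : ℕ} {Ω : Type*} [MeasurableSpace Ω] {P : Measure Ω}
  {R : Fin θ → Ω → Finset (V × Fin r)}

omit [Nonempty V] [NeZero r] in
theorem aemeasurable_coveredWeight {X : Ω → Finset (V × Fin r)} (hX : AEMeasurable X P)
    (S : Finset V) : AEMeasurable (fun ω => N.coveredWeight S (X ω)) P :=
  (Measurable.of_discrete (f := N.coveredWeight S)).comp_aemeasurable hX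

omit [Nonempty V] [NeZero r] in
theorem iIndepFun_coveredWeight (hindep : iIndepFun R P) (S : Finset V) :
    iIndepFun (fun j ω => N.coveredWeight S (R j ω)) P :=
  hindep.comp (fun _ => N.coveredWeight S) fun _ => Measurable.of_discrete

theorem ae_coveredWeight_mem_Icc {X : Ω → Finset (V × Fin r)}
    (hX : HasLaw X N.multiSampling.toMeasure P) (S : Finset V) :
    ∀ᵐ ω ∂P, N.coveredWeight S (X ω) ∈ Set.Icc 0 N.maxWeight := by
  have h := N.coveredWeight_mem_Icc S
  rw [← hX.map_eq] at h
  exact ae_of_ae_map hX.aemeasurable h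

theorem integral_coveredWeight_comp {X : Ω → Finset (V × Fin r)}
    (hX : HasLaw X N.multiSampling.toMeasure P) {S : Finset V} (hS : S.Nonempty) :
    ∫ ω, N.coveredWeight S (X ω) ∂P = N.objective S / (Fintype.card V * r) := by
  rw [← N.integral_coveredWeight hS]
  exact hX.integral_comp (f := N.coveredWeight S)
    Measurable.of_discrete.aestronglyMeasurable

theorem card_mul_pos (V : Type*) [Fintype V] [Nonempty V] (r : ℕ) [NeZero r] :
    (0 : ℝ) < Fintype.card V * r :=
  mul_pos (by exact_mod_cast Fintype.card_pos) (by exact_mod_cast Nat.pos_of_ne_zero (NeZero.ne r))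

variable [IsProbabilityMeasure P]

/-- With `theta₁` samples, the coverage of an optimal set is rarely underestimated. -/
theorem prob_coverage_optimal_le {k : ℕ} {ε₁ δ₁ : ℝ} (hε₁ : 0 < ε₁) (hδ₁ : 0 < δ₁)
    (hθ : N.theta₁ k ε₁ δ₁ ≤ θ) (hlaw : ∀ j, HasLaw (R j) N.multiSampling.toMeasure P)
    (hindep : iIndepFun R P) {T : Finset V} (hT : T.Nonempty) (hopt : N.objective T = N.opt k)
    (hpos : 0 < N.opt k) :
    P.real {ω | ∑ j, N.coveredWeight T (R j ω) ≤
      (1 - ε₁) * (θ * (N.opt k / (Fintype.card V * r)))} ≤ δ₁ := by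
  have hD := card_mul_pos V r
  have hw := N.maxWeight_pos
  refine (chernoff_lower_tail (fun j => aemeasurable_coveredWeight (hlaw j).aemeasurable T)
    (iIndepFun_coveredWeight hindep T) hw hε₁ (fun j => ae_coveredWeight_mem_Icc (hlaw j) T)
    fun j => by rw [integral_coveredWeight_comp (hlaw j) hT, hopt]).trans ?_
  refine Real.exp_neg_le_of_log_le hδ₁ ?_
  rw [theta₁, div_le_iff₀ (by positivity)] at hθ
  have : θ * (ε₁ ^ 2 * (N.opt k / (Fintype.card V * r)) / (2 * N.maxWeight)) =
      θ * (ε₁ ^ 2 * N.opt k) / (2 * (Fintype.card V * r) * N.maxWeight) := by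
    field_simp
  rw [this, le_div_iff₀ (by positivity)]
  linarith

/-- With `theta₂` samples, the coverage of a given feasible set is rarely overestimated. -/
theorem prob_le_coverage_le {k : ℕ} {ε₂ δ₂ : ℝ} (hε₂ : 0 < ε₂) (hδ₂ : 0 < δ₂)
    (hkn : k ≤ Fintype.card V - N.rumorSeeds.card)
    (hθ : N.theta₂ k ε₂ δ₂ ≤ θ) (hlaw : ∀ j, HasLaw (R j) N.multiSampling.toMeasure P)
    (hindep : iIndepFun R P) {S : Finset V} (hS : S.Nonempty) (hf : S ∈ N.feasible k)
    (hpos : 0 < N.opt k) :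
    P.real {ω | θ * (N.objective S / (Fintype.card V * r) +
      ε₂ * (N.opt k / (Fintype.card V * r))) ≤ ∑ j, N.coveredWeight S (R j ω)} ≤
      δ₂ / (Fintype.card V - N.rumorSeeds.card).choose k := by
  have hD := card_mul_pos V r
  have hw := N.maxWeight_pos
  have hC : (0 : ℝ) < (Fintype.card V - N.rumorSeeds.card).choose k := by
    exact_mod_cast Nat.choose_pos hkn
  have hle : N.objective S ≤ N.opt k := Finset.le_sup' N.objective hf
  -- Here ν = OPT/(nr): the deviation is measured against OPT rather than f(S), which gives the same
  -- failure bound for every S.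
  refine (bernstein_upper_tail (fun j => aemeasurable_coveredWeight (hlaw j).aemeasurable S)
    (iIndepFun_coveredWeight hindep S) hw N.maxWeight_le_one hε₂
    (fun j => ae_coveredWeight_mem_Icc (hlaw j) S)
    (fun j => integral_coveredWeight_comp (hlaw j) hS)
    (div_le_div_of_nonneg_right hle hD.le)).trans ?_
  refine Real.exp_neg_le_of_log_le (by positivity) ?_
  rw [theta₂, div_le_iff₀ (by positivity)] at hθ
  have : θ * (ε₂ ^ 2 * (N.opt k / (Fintype.card V * r)) / (2 * N.maxWeight + 2 / 3 * ε₂)) =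
      θ * (ε₂ ^ 2 * N.opt k) / ((2 * N.maxWeight + 2 / 3 * ε₂) * (Fintype.card V * r)) := by
    field_simp
  rw [this, le_div_iff₀ (by positivity), one_div_div]
  linarith

/-- If the coverage does not underestimate the optimal set `T` and does not overestimate the greedy
set `S`, then `S` is an approximate solution. -/
theorem NodeSelection.isApproxSolution {k : ℕ} (hk : 1 ≤ k) (hθ : 0 < θ)
    {Q : Fin θ → Finset (V × Fin r)} {S T : Finset V} (h : N.NodeSelection Q k S)
    (hT : T ∈ N.feasible k) {ε ε₁ ε₂ : ℝ} (hε₂ : ε₂ = ε - (1 - 1 / Real.exp 1) * ε₁)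
    (hlow : (1 - ε₁) * (θ * (N.opt k / (Fintype.card V * r))) < ∑ j, N.coveredWeight T (Q j))
    (hup : ∑ j, N.coveredWeight S (Q j) < θ * (N.objective S / (Fintype.card V * r) +
      ε₂ * (N.opt k / (Fintype.card V * r)))) :
    N.IsApproxSolution k (1 - 1 / Real.exp 1 - ε) S := by
  have hD := card_mul_pos V r
  have hθ0 : (0 : ℝ) < θ := by exact_mod_cast hθ
  refine ⟨mem_feasible.2 ⟨h.disjoint_and_card.1, h.disjoint_and_card.2.le⟩, ?_⟩
  have hT' := mem_feasible.1 hT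
  have hg := h.le_coverage hk hT'.1 hT'.2
  rw [coverage_eq, coverage_eq, mul_left_comm] at hg
  have hg' := le_of_mul_le_mul_left hg (by positivity)
  have he : 0 ≤ 1 - 1 / Real.exp 1 := by
    rw [sub_nonneg, div_le_one (Real.exp_pos 1)]
    exact Real.one_le_exp zero_le_one
  have h1 := (mul_le_mul_of_nonneg_left hlow.le he).trans (hg'.trans hup.le)
  -- After cancelling θ/(nr), the constant is (1 - 1/e)(1 - ε₁) - ε₂ = 1 - 1/e - ε.
  have h2 : θ / (Fintype.card V * r) * ((1 - 1 / Real.exp 1) * (1 - ε₁) * N.opt k) ≤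
      θ / (Fintype.card V * r) * (N.objective S + ε₂ * N.opt k) := by
    refine Eq.trans_le ?_ (h1.trans_eq ?_) <;> ring
  have h3 := le_of_mul_le_mul_left h2 (div_pos hθ0 hD)
  rw [hε₂] at h3
  linarith

end RumorNetwork

theorem theorem3 {V : Type*} [Fintype V] [DecidableEq V] [Nonempty V] {r : ℕ} [NeZero r]
    (N : RumorNetwork V r) (k : ℕ) (hk : 1 ≤ k)
    (hkn : k + N.rumorSeeds.card ≤ Fintype.card V)
    (ε ε₁ ε₂ δ₁ δ₂ ℓ : ℝ) (hε₁ : 0 < ε₁) (hε : ε₁ < ε)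
    (hε₂ : ε₂ = ε - (1 - 1 / Real.exp 1) * ε₁)
    (hδ₁ : δ₁ ∈ Set.Ioo (0 : ℝ) 1) (hδ₂ : δ₂ ∈ Set.Ioo (0 : ℝ) 1)
    (hδ : δ₁ + δ₂ ≤ 1 / (Fintype.card V : ℝ) ^ ℓ)
    (θ : ℕ) (hθ : max (N.theta₁ k ε₁ δ₁) (N.theta₂ k ε₂ δ₂) ≤ (θ : ℝ))
    {Ω : Type*} [MeasurableSpace Ω] (P : Measure Ω) [IsProbabilityMeasure P]
    (R : Fin θ → Ω → Finset (V × Fin r))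
    (hlaw : ∀ j, HasLaw (R j) N.multiSampling.toMeasure P)
    (hindep : iIndepFun R P) :
    1 - 1 / (Fintype.card V : ℝ) ^ ℓ ≤
      P.real {ω | (∃ S, N.NodeSelection (fun j => R j ω) k S) ∧
        ∀ S, N.NodeSelection (fun j => R j ω) k S →
          N.IsApproxSolution k (1 - 1 / Real.exp 1 - ε) S} := by
  obtain ⟨hθ₁, hθ₂⟩ := max_le_iff.1 hθ
  obtain ⟨T, hT, hTne, hopt, hpos⟩ := N.exists_nonempty_optimal hk hkn
  have hkn' : k ≤ Fintype.card V - N.rumorSeeds.card := by omega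
  have hC : (0 : ℝ) < (Fintype.card V - N.rumorSeeds.card).choose k := by
    exact_mod_cast Nat.choose_pos hkn'
  have hε₂pos : 0 < ε₂ := by
    have : (0 : ℝ) < 1 / Real.exp 1 := by positivity
    rw [hε₂]
    nlinarith
  have hθpos : 0 < θ := by
    have hD := RumorNetwork.card_mul_pos V r
    have hlog : 0 < Real.log (1 / δ₁) := Real.log_pos (by
      rw [one_lt_div hδ₁.1]; exact hδ₁.2)
    have hw := N.maxWeight_pos
    have h0 : 0 < N.theta₁ k ε₁ δ₁ := by
      rw [RumorNetwork.theta₁, mul_assoc 2]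
      positivity
    exact_mod_cast h0.trans_le hθ₁
  -- Every greedy output has exactly k users, so the union bound runs over k-sets only, whatever the
  -- tie-breaking.
  set C := (Finset.univ \ N.rumorSeeds).powersetCard k with hCdef
  have hCcard : C.card = (Fintype.card V - N.rumorSeeds.card).choose k := by
    rw [hCdef, Finset.card_powersetCard, Finset.card_sdiff_of_subset (Finset.subset_univ _),
      Finset.card_univ]
  have hCmem : ∀ S, S ∈ C ↔ Disjoint S N.rumorSeeds ∧ S.card = k := by
    intro S
    simp [hCdef, Finset.mem_powersetCard, Finset.subset_sdiff]
  set low := {ω | ∑ j, N.coveredWeight T (R j ω) ≤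
    (1 - ε₁) * (θ * (N.opt k / (Fintype.card V * r)))} with hlow
  set up : Finset V → Set Ω := fun S => {ω | θ * (N.objective S / (Fintype.card V * r) +
    ε₂ * (N.opt k / (Fintype.card V * r))) ≤ ∑ j, N.coveredWeight S (R j ω)} with hup
  set good := {ω | (∃ S, N.NodeSelection (fun j => R j ω) k S) ∧
    ∀ S, N.NodeSelection (fun j => R j ω) k S →
      N.IsApproxSolution k (1 - 1 / Real.exp 1 - ε) S} with hgood
  have hPlow : P.real low ≤ δ₁ :=
    RumorNetwork.prob_coverage_optimal_le hε₁ hδ₁.1 hθ₁ hlaw hindep hTne hopt hpos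
  have hPup : P.real (⋃ S ∈ C, up S) ≤ δ₂ := by
    refine (measureReal_biUnion_finset_le C up).trans ?_
    refine (Finset.sum_le_sum
      (g := fun _ => δ₂ / (Fintype.card V - N.rumorSeeds.card).choose k) fun S hS => ?_).trans ?_
    · have hS' := (hCmem S).1 hS
      exact RumorNetwork.prob_le_coverage_le hε₂pos hδ₂.1 hkn' hθ₂ hlaw hindep
        (Finset.card_pos.1 (by omega)) (RumorNetwork.mem_feasible.2 ⟨hS'.1, hS'.2.le⟩) hpos
    · rw [Finset.sum_const, hCcard, nsmul_eq_mul, mul_div_cancel₀ _ hC.ne']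
  have hcover : Set.univ ⊆ good ∪ (low ∪ ⋃ S ∈ C, up S) := by
    intro ω _
    by_contra hω
    simp only [Set.mem_union, Set.mem_iUnion, not_or, not_exists] at hω
    obtain ⟨hg, hl, hu⟩ := hω
    refine hg ⟨RumorNetwork.exists_nodeSelection hkn, fun S hS => ?_⟩
    exact hS.isApproxSolution hk hθpos hT hε₂ (not_le.1 hl)
      (not_le.1 (hu S ((hCmem S).2 hS.disjoint_and_card)))
  -- Covering the whole space and using subadditivity avoids any measurability claim about `good`.
  have h1 : (1 : ℝ) ≤ P.real good + (P.real low + P.real (⋃ S ∈ C, up S)) := by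
    rw [← probReal_univ (μ := P)]
    exact (measureReal_mono hcover).trans ((measureReal_union_le _ _).trans
      (add_le_add_right (measureReal_union_le _ _) _))
  linarith
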